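/- Consider a base station with $N_{\mathrm T}$ transmit and $N_{\mathrm R}$ receive antennas and $K$ single-antenna users. Let $\boldsymbol a(\phi,\theta)\in\mathbb C^{N_{\mathrm T}}$ and $\boldsymbol b(\phi,\theta)\in\mathbb C^{N_{\mathrm R}}$ be the transmit and receive steering vectors at the known elevation angle $\phi$, continuously differentiable in the azimuth $\theta$ with $\theta$-derivatives $\dot{\boldsymbol a},\dot{\boldsymbol b}$, and let $p_\Theta$ be a probability density of $\theta$ on $[-\pi,\pi)$. Put $$\boldsymbol A_1=\int_{-\pi}^{\pi}\bigl(\|\dot{\boldsymbol b}\|^2\boldsymbol a\boldsymbol a^H+N_{\mathrm R}\dot{\boldsymbol a}\dot{\boldsymbol a}^H\bigr)p_\Theta(\theta)\,d\theta,\quad \boldsymbol A_2=N_{\mathrm R}\int_{-\pi}^{\pi}\dot{\boldsymbol a}\boldsymbol a^H p_\Theta(\theta)\,d\theta,\quad \boldsymbol A_3=N_{\mathrm R}\int_{-\pi}^{\pi}\boldsymbol a\boldsymbol a^H p_\Theta(\theta)\,d\theta .$$ For each user $k$ let $\boldsymbol h_k\in\mathbb C^{N_{\mathrm T}}$ be the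 channel vector, $\sigma_k^2>0$ the noise power, $\bar R_k>0$ the rate target and $\gamma_k=2^{\bar R_k}-1$; let $P$ be the power budget. Consider the semidefinite program (P2-R) in the variables $t\in\mathbb R$ and $\boldsymbol W_1,\dots,\boldsymbol W_K,\boldsymbol W_{\mathrm S}\in\mathbb C^{N_{\mathrm T}\times N_{\mathrm T}}$, where $\boldsymbol R_X=\sum_{k=1}^K\boldsymbol W_k+\boldsymbol W_{\mathrm S}$: maximize $t$ subject to $$\begin{bmatrix}\mathrm{tr}(\boldsymbol A_1\boldsymbol R_X)-t&\mathrm{tr}(\boldsymbol A_2\boldsymbol R_X)\\ \mathrm{tr}(\boldsymbol A_2^H\boldsymbol R_X)&\mathrm{tr}(\boldsymbol A_3\boldsymbol R_X)\end{bmatrix}\succeq\boldsymbol 0,\qquad \boldsymbol h_k^H\Bigl(\boldsymbol W_k-\gamma_k\sum_{i\ne k}\boldsymbol W_i\Bigr)\boldsymbol h_k\ge\gamma_k\sigma_k^2\ \ \forall k,$$ $$\mathrm{tr}(\boldsymbol R_X)\le P,\qquad \boldsymbol W_k\succeq\boldsymbol 0\ \ \forall k,\qquad \boldsymbol W_{\mathrm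 S}\succeq\boldsymbol 0 .$$ Let $(t^\star,\{\boldsymbol W_k^\star\}_{k=1}^K,\boldsymbol W_{\mathrm S}^\star)$ be any optimal solution of (P2-R). Then $\boldsymbol W_k^\star\boldsymbol h_k\neq\boldsymbol 0$ for every $k$, and there exist $\beta_1,\dots,\beta_K\in(0,1]$ with $\sum_{k=1}^K\beta_k\le1$ and a matrix $\hat{\boldsymbol W}_{\mathrm S}^\star$ with $\mathrm{rank}(\hat{\boldsymbol W}_{\mathrm S}^\star)\le1$ such that, with $$\hat{\boldsymbol W}_k^\star=\beta_kP\,\frac{\boldsymbol W_k^\star\boldsymbol h_k\boldsymbol h_k^H\boldsymbol W_k^\star}{\|\boldsymbol W_k^\star\boldsymbol h_k\|^2},\qquad k=1,\dots,K,$$ $(t^\star,\{\hat{\boldsymbol W}_k^\star\}_{k=1}^K,\hat{\boldsymbol W}_{\mathrm S}^\star)$ is also an optimal solution of (P2-R). (It need not be distinct from the given one.) -/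

import Mathlib

open scoped ComplexOrder Matrix

noncomputable section

/-- The rank-one (or zero) matrix `u vᴴ`. -/
def outer {n : ℕ} (u v : EuclideanSpace ℂ (Fin n)) : Matrix (Fin n) (Fin n) ℂ :=
  Matrix.vecMulVec u.ofLp (star v.ofLp)

/-- The matrix-vector product `M u`, as a Euclidean vector. -/
def mulVecE {n : ℕ} (M : Matrix (Fin n) (Fin n) ℂ) (u : EuclideanSpace ℂ (Fin n)) :
    EuclideanSpace ℂ (Fin n) :=
  WithLp.toLp 2 (M *ᵥ u.ofLp)

/-- The quadratic form `uᴴ M u`. It is real when `M` is Hermitian. -/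
def quadForm {n : ℕ} (u : EuclideanSpace ℂ (Fin n)) (M : Matrix (Fin n) (Fin n) ℂ) : ℝ :=
  (star u.ofLp ⬝ᵥ (M *ᵥ u.ofLp)).re

/-- The data of a multi-user integrated sensing and communication system with `NT` transmit
antennas, `NR` receive antennas and `K` single-antenna users. -/
structure ISACSystem (NT NR K : ℕ) where
  /-- transmit steering vector, as a function of elevation and azimuth -/
  a : ℝ → ℝ → EuclideanSpace ℂ (Fin NT)
  /-- receive steering vector, as a function of elevation and azimuth -/
  b : ℝ → ℝ → EuclideanSpace ℂ (Fin NR)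
  /-- known elevation angle of the target -/
  φ : ℝ
  /-- prior density of the azimuth angle on `[-π, π)` -/
  p : ℝ → ℝ
  /-- channel vectors of the users (user `k` sees the row vector `(h k)ᴴ`) -/
  h : Fin K → EuclideanSpace ℂ (Fin NT)
  /-- noise standard deviations, so that the noise power at user `k` is `σ k ^ 2` -/
  σ : Fin K → ℝ
  /-- rate targets of the users, in bits per second per hertz -/
  Rbar : Fin K → ℝ
  /-- transmit power budget -/
  P : ℝ

namespace ISACSystem

variable {NT NR K : ℕ} (S : ISACSystem NT NR K)

/-- Derivative of the transmit steering vector with respect to the azimuth. -/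
def aDot (θ : ℝ) : EuclideanSpace ℂ (Fin NT) := deriv (fun ϑ => S.a S.φ ϑ) θ

/-- Derivative of the receive steering vector with respect to the azimuth. -/
def bDot (θ : ℝ) : EuclideanSpace ℂ (Fin NR) := deriv (fun ϑ => S.b S.φ ϑ) θ

/-- `A₁ = ∫ (‖ḃ‖² a aᴴ + N_R ȧ ȧᴴ) p dθ`. -/
def A₁ : Matrix (Fin NT) (Fin NT) ℂ := Matrix.of fun i j =>
  ∫ θ in (-Real.pi)..Real.pi,
    (((‖S.bDot θ‖ ^ 2 : ℝ) : ℂ) * outer (S.a S.φ θ) (S.a S.φ θ) i j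
      + (NR : ℂ) * outer (S.aDot θ) (S.aDot θ) i j) * (S.p θ : ℂ)

/-- `A₂ = N_R ∫ ȧ aᴴ p dθ`. -/
def A₂ : Matrix (Fin NT) (Fin NT) ℂ := Matrix.of fun i j =>
  (NR : ℂ) * ∫ θ in (-Real.pi)..Real.pi, outer (S.aDot θ) (S.a S.φ θ) i j * (S.p θ : ℂ)

/-- `A₃ = N_R ∫ a aᴴ p dθ`. -/
def A₃ : Matrix (Fin NT) (Fin NT) ℂ := Matrix.of fun i j =>
  (NR : ℂ) * ∫ θ in (-Real.pi)..Real.pi, outer (S.a S.φ θ) (S.a S.φ θ) i j * (S.p θ : ℂ)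

/-- The SINR threshold `γ_k = 2 ^ R̄_k - 1`. -/
def γ (k : Fin K) : ℝ := (2 : ℝ) ^ S.Rbar k - 1

/-- The transmit covariance matrix `R_X = ∑ W_k + W_S`. -/
def RX (W : Fin K → Matrix (Fin NT) (Fin NT) ℂ) (WS : Matrix (Fin NT) (Fin NT) ℂ) :
    Matrix (Fin NT) (Fin NT) ℂ :=
  (∑ k, W k) + WS

/-- The `2 × 2` matrix `B(t, {W_k}, W_S)`. -/
def B (t : ℝ) (W : Fin K → Matrix (Fin NT) (Fin NT) ℂ) (WS : Matrix (Fin NT) (Fin NT) ℂ) :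
    Matrix (Fin 2) (Fin 2) ℂ :=
  !![(S.A₁ * RX W WS).trace - (t : ℂ), (S.A₂ * RX W WS).trace;
     (S.A₂ᴴ * RX W WS).trace, (S.A₃ * RX W WS).trace]

/-- Feasibility of `(t, {W_k}, W_S)` for the relaxed beamforming problem. -/
structure IsFeasible (t : ℝ) (W : Fin K → Matrix (Fin NT) (Fin NT) ℂ)
    (WS : Matrix (Fin NT) (Fin NT) ℂ) : Prop where
  sensing : (S.B t W WS).PosSemidef
  rate : ∀ k, S.γ k * S.σ k ^ 2 ≤
    quadForm (S.h k) (W k - S.γ k • ∑ i ∈ Finset.univ.erase k, W i)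
  power : ((∑ k, W k) + WS).trace.re ≤ S.P
  comm_psd : ∀ k, (W k).PosSemidef
  sens_psd : WS.PosSemidef

/-- Optimality for the relaxed problem: feasible, with the largest objective value `t`. -/
def IsOptimal (t : ℝ) (W : Fin K → Matrix (Fin NT) (Fin NT) ℂ)
    (WS : Matrix (Fin NT) (Fin NT) ℂ) : Prop :=
  S.IsFeasible t W WS ∧ ∀ t' W' WS', S.IsFeasible t' W' WS' → t' ≤ t

end ISACSystem

end

/-! Write `q_k = h_kᴴ W_k h_k`, positive by the rate constraint. Deflation gives `V_k = W_k h_k h_kᴴ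
W_k / q_k ≤ W_k` with the same useful power at user `k` and no more interference at the others
(`sub_deflation`). The leftovers `W_k - V_k` join the sensing part, which no rate constraint sees,
so `R_X` is unchanged.

The enlarged sensing part `T` is then reduced to rank one. A Schur multiplier `z` of the sensing
matrix (`exists_schur`), held fixed, turns the sensing constraint into one complex linear equation
and one real linear inequality in `R_X` (`B_posSemidef_of_trace_le`). With the trace these are three
real equalities and one inequality. `exists_merge` respects them while merging two vectors into one:
Hermitian `2 × 2` matrices have real dimension four, so a nonzero perturbation `D` of the identity
keeps the equalities, and its sign is free for the inequality. Repeated merging collapses `T` to a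
single `w wᴴ`. -/

/-! ### Rank-one reduction of positive semidefinite matrices. -/

/-- For `D = !![a, b; star b, d]` with `det D < 0`, `det (1 + s D)` is `1` at `s = 0` and tends to
`-∞`. At its positive root `1 + s D` is semidefinite of rank at most one; `x`, `y` factor it. -/
theorem exists_singular_perturbation {a d : ℝ} {b : ℂ} (h : a * d < Complex.normSq b) :
    ∃ (s : ℝ) (x y : ℂ), 0 < s ∧ star x * x = ((1 + s * a : ℝ) : ℂ) ∧
      star y * y = ((1 + s * d : ℝ) : ℂ) ∧ star x * y = s * b := by
  obtain ⟨s, hs, hq⟩ : ∃ s : ℝ, 0 < s ∧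
      (1 + s * a) * (1 + s * d) = s ^ 2 * Complex.normSq b := by
    set m := Complex.normSq b - a * d with hm
    have hmpos : 0 < m := by linarith
    have hr : Real.sqrt ((a + d) ^ 2 + 4 * m) ^ 2 = (a + d) ^ 2 + 4 * m :=
      Real.sq_sqrt (by positivity)
    have hlt : -(a + d) < Real.sqrt ((a + d) ^ 2 + 4 * m) := by
      apply lt_of_le_of_lt (neg_le_abs _)
      rw [← Real.sqrt_sq_eq_abs]
      exact Real.sqrt_lt_sqrt (sq_nonneg _) (by linarith)
    -- The positive root of `m s² - (a + d) s - 1 = 0`.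
    refine ⟨((a + d) + Real.sqrt ((a + d) ^ 2 + 4 * m)) / (2 * m),
      div_pos (by linarith) (by linarith), ?_⟩
    have hb : Complex.normSq b = m + a * d := by linarith
    rw [hb]
    set r := Real.sqrt ((a + d) ^ 2 + 4 * m)
    field_simp
    linear_combination (-m) * hr
  have hbn : 0 ≤ Complex.normSq b := Complex.normSq_nonneg b
  have hs2 : 0 < s ^ 2 := by positivity
  have hlt : s ^ 2 * (a * d) < s ^ 2 * Complex.normSq b := by gcongr
  -- The diagonal entries have nonnegative product, and `hq` with `hlt` gives `1 + s (a + d) > 0`,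
  -- so neither can be negative.
  have ha : 0 ≤ 1 + s * a := by
    by_contra hneg
    push Not at hneg
    have : 0 ≤ (1 + s * a) * (1 + s * d) := by rw [hq]; positivity
    have hd : 1 + s * d ≤ 0 := by
      by_contra hc
      push Not at hc
      nlinarith
    nlinarith
  rcases ha.eq_or_lt with ha0 | hapos
  · have hb : Complex.normSq b = 0 := by
      rw [← ha0, zero_mul] at hq
      rcases mul_eq_zero.1 hq.symm with h0 | h0
      · exact absurd h0 hs2.ne'
      · exact h0
    have hd : 0 ≤ 1 + s * d := by
      have h1 : a < 0 := by nlinarith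
      have h2 : 0 < d := by
        by_contra hc
        push Not at hc
        nlinarith
      positivity
    refine ⟨s, 0, (Real.sqrt (1 + s * d) : ℂ), hs, ?_, ?_, ?_⟩
    · simp [← ha0]
    · rw [RCLike.star_def, Complex.conj_ofReal, ← Complex.ofReal_mul, Real.mul_self_sqrt hd]
    · simp [Complex.normSq_eq_zero.1 hb]
  · have hx : Real.sqrt (1 + s * a) ≠ 0 := (Real.sqrt_pos.2 hapos).ne'
    refine ⟨s, (Real.sqrt (1 + s * a) : ℂ), s * b / (Real.sqrt (1 + s * a) : ℂ), hs, ?_, ?_, ?_⟩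
    · rw [RCLike.star_def, Complex.conj_ofReal, ← Complex.ofReal_mul, Real.mul_self_sqrt ha]
    · rw [RCLike.star_def, mul_comm, Complex.mul_conj, Complex.normSq_div, Complex.normSq_mul,
        Complex.normSq_ofReal, Complex.normSq_ofReal, Real.mul_self_sqrt ha]
      congr 1
      rw [div_eq_iff hapos.ne']
      linarith
    · rw [RCLike.star_def, Complex.conj_ofReal, mul_div_cancel₀]
      exact_mod_cast hx

variable {ι : Type*} [Fintype ι]

theorem star_dotProduct_mulVec_add_smul (M : Matrix ι ι ℂ) (u v : ι → ℂ) (x y : ℂ) :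
    star (x • u + y • v) ⬝ᵥ (M *ᵥ (x • u + y • v)) =
      (star x * x) * (star u ⬝ᵥ (M *ᵥ u)) + (star y * y) * (star v ⬝ᵥ (M *ᵥ v)) +
      (star x * y) * (star u ⬝ᵥ (M *ᵥ v)) + star (star x * y) * (star v ⬝ᵥ (M *ᵥ u)) := by
  simp only [star_add, star_smul, Matrix.mulVec_add, Matrix.mulVec_smul, add_dotProduct,
    dotProduct_add, smul_dotProduct, dotProduct_smul, smul_eq_mul, star_mul, star_star]
  ring

/-- The linear form `D ↦ ∑ D i j * (e i)ᴴ M (e j)` on Hermitian `2 × 2` matrices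
`D = !![a, b; star b, d]`, for `e = ![u, v]`. -/
def hermitianPairing (M : Matrix ι ι ℂ) (u v : ι → ℂ) : ℝ × ℝ × ℂ →ₗ[ℝ] ℂ where
  toFun D := D.1 * (star u ⬝ᵥ (M *ᵥ u)) + D.2.1 * (star v ⬝ᵥ (M *ᵥ v)) +
      D.2.2 * (star u ⬝ᵥ (M *ᵥ v)) + star D.2.2 * (star v ⬝ᵥ (M *ᵥ u))
  map_add' D E := by simp; ring
  map_smul' r D := by simp; ring

/-- Dimension count: four real unknowns against three real equations. -/
theorem exists_ne_zero_hermitianPairing (C E : Matrix ι ι ℂ) (u v : ι → ℂ) :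
    ∃ D : ℝ × ℝ × ℂ, D ≠ 0 ∧ hermitianPairing C u v D = 0 ∧ (hermitianPairing E u v D).re = 0 := by
  let f : ℝ × ℝ × ℂ →ₗ[ℝ] ℂ × ℝ :=
    (hermitianPairing C u v).prod (Complex.reLm ∘ₗ hermitianPairing E u v)
  have hker : LinearMap.ker f ≠ ⊥ := by
    apply LinearMap.ker_ne_bot_of_finrank_lt
    simp [Module.finrank_prod, Complex.finrank_real_complex]
  obtain ⟨D, hD, hD0⟩ := (Submodule.ne_bot_iff _).1 hker
  have hf : f D = 0 := hD
  exact ⟨D, hD0, congrArg Prod.fst hf, congrArg Prod.snd hf⟩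

theorem trace_mul_vecMulVec_star (M : Matrix ι ι ℂ) (w : ι → ℂ) :
    (M * Matrix.vecMulVec w (star w)).trace = star w ⬝ᵥ (M *ᵥ w) := by
  rw [Matrix.mul_vecMulVec, Matrix.trace_vecMulVec, dotProduct_comm]

variable [DecidableEq ι]

/-- Realness makes the norm constraint cost one real equation instead of two. -/
theorem star_hermitianPairing_one (u v : ι → ℂ) (D : ℝ × ℝ × ℂ) :
    star (hermitianPairing 1 u v D) = hermitianPairing 1 u v D := by
  have hsd (x y : ι → ℂ) : (starRingEnd ℂ) (star x ⬝ᵥ y) = star y ⬝ᵥ x := by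
    rw [← RCLike.star_def, Matrix.star_dotProduct, star_star]
  simp only [hermitianPairing, LinearMap.coe_mk, AddHom.coe_mk, Matrix.one_mulVec,
    RCLike.star_def, map_add, map_mul, Complex.conj_ofReal, Complex.conj_conj, hsd]
  ring

/-- A nonzero semidefinite `D` can pair to zero with the Gram matrix of `u`, `v` only if the two are
dependent: `‖a u + b v‖² = (|b|² - a d) ‖v‖² ≤ 0`. -/
theorem exists_smul_eq_of_hermitianPairing_one_eq_zero {u v : ι → ℂ} {D : ℝ × ℝ × ℂ}
    (hD : D ≠ 0) (hdet : Complex.normSq D.2.2 ≤ D.1 * D.2.1)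
    (h : hermitianPairing 1 u v D = 0) : v = 0 ∨ ∃ c : ℂ, u = c • v := by
  obtain ⟨a, d, b⟩ := D
  simp only [hermitianPairing, LinearMap.coe_mk, AddHom.coe_mk, Matrix.one_mulVec] at h hdet
  by_cases ha : a = 0
  · left
    subst ha
    have hb : b = 0 := Complex.normSq_eq_zero.1
      (le_antisymm (by simpa using hdet) (Complex.normSq_nonneg b))
    subst hb
    have hd : (d : ℂ) ≠ 0 := by
      intro hd
      apply hD
      simp [Complex.ofReal_eq_zero.1 hd]
    have hv : star v ⬝ᵥ v = 0 := by simpa [hd] using h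
    exact dotProduct_star_self_eq_zero.1 hv
  · right
    have ha' : (a : ℂ) ≠ 0 := Complex.ofReal_ne_zero.2 ha
    have hw := star_dotProduct_mulVec_add_smul (1 : Matrix ι ι ℂ) u v (a : ℂ) b
    simp only [Matrix.one_mulVec, RCLike.star_def, Complex.conj_ofReal, map_mul] at hw h
    have hw2 : star ((a : ℂ) • u + b • v) ⬝ᵥ ((a : ℂ) • u + b • v) =
        ((Complex.normSq b - a * d : ℝ) : ℂ) * (star v ⬝ᵥ v) := by
      rw [hw, mul_comm ((starRingEnd ℂ) b) b, Complex.mul_conj]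
      push_cast
      linear_combination (a : ℂ) * h
    have hle : star ((a : ℂ) • u + b • v) ⬝ᵥ ((a : ℂ) • u + b • v) ≤ 0 := by
      rw [hw2]
      apply mul_nonpos_of_nonpos_of_nonneg
      · exact_mod_cast sub_nonpos.2 hdet
      · exact dotProduct_star_self_nonneg v
    have h0 : (a : ℂ) • u + b • v = 0 :=
      dotProduct_star_self_eq_zero.1 (le_antisymm hle (dotProduct_star_self_nonneg _))
    refine ⟨-(b / a), ?_⟩
    ext i
    have := congrFun h0 i
    simp only [Pi.add_apply, Pi.smul_apply, smul_eq_mul, Pi.zero_apply] at this ⊢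
    field_simp
    linear_combination this

/-- Two vectors can be merged into one, keeping the sum of the squared norms and the sum of the
values of one complex quadratic form, and not decreasing the real part of another. -/
theorem exists_merge (C G : Matrix ι ι ℂ) (u v : ι → ℂ) :
    ∃ w : ι → ℂ, star w ⬝ᵥ w = star u ⬝ᵥ u + star v ⬝ᵥ v ∧
      star w ⬝ᵥ (C *ᵥ w) = star u ⬝ᵥ (C *ᵥ u) + star v ⬝ᵥ (C *ᵥ v) ∧
      (star u ⬝ᵥ (G *ᵥ u) + star v ⬝ᵥ (G *ᵥ v)).re ≤ (star w ⬝ᵥ (G *ᵥ w)).re := by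
  obtain ⟨D, hD, hC, hI, hG⟩ : ∃ D : ℝ × ℝ × ℂ, D ≠ 0 ∧ hermitianPairing C u v D = 0 ∧
      hermitianPairing 1 u v D = 0 ∧ 0 ≤ (hermitianPairing G u v D).re := by
    obtain ⟨D, hD, hC, hI⟩ := exists_ne_zero_hermitianPairing C 1 u v
    have hI' : hermitianPairing 1 u v D = 0 := by
      have := star_hermitianPairing_one u v D
      rw [RCLike.star_def, Complex.conj_eq_iff_re, hI] at this
      simpa using this.symm
    rcases le_total 0 (hermitianPairing G u v D).re with h | h
    · exact ⟨D, hD, hC, hI', h⟩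
    -- The equalities are homogeneous in `D`, so its sign is free.
    · exact ⟨-D, neg_ne_zero.2 hD, by simp [hC], by simp [hI'], by simpa using h⟩
  rcases le_or_gt (Complex.normSq D.2.2) (D.1 * D.2.1) with hdet | hdet
  · rcases exists_smul_eq_of_hermitianPairing_one_eq_zero hD hdet hI with rfl | ⟨c, rfl⟩
    · exact ⟨u, by simp, by simp, by simp⟩
    -- Parallel vectors merge exactly, as `|c|² + 1 = r²`.
    · set r : ℂ := (Real.sqrt (Complex.normSq c + 1) : ℂ)
      have hr : star r * r = star c * c + 1 := by
        rw [RCLike.star_def, Complex.conj_ofReal, ← Complex.ofReal_mul,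
          Real.mul_self_sqrt (by have := Complex.normSq_nonneg c; positivity), mul_comm,
          Complex.mul_conj]
        push_cast
        rfl
      have key (M : Matrix ι ι ℂ) : star (r • v) ⬝ᵥ (M *ᵥ (r • v)) =
          star (c • v) ⬝ᵥ (M *ᵥ (c • v)) + star v ⬝ᵥ (M *ᵥ v) := by
        simp only [star_smul, Matrix.mulVec_smul, smul_dotProduct, dotProduct_smul, smul_eq_mul]
        linear_combination (star v ⬝ᵥ (M *ᵥ v)) * hr
      exact ⟨r • v, by simpa using key 1, key C, by rw [key G]⟩
  · obtain ⟨s, x, y, hs, hx, hy, hxy⟩ := exists_singular_perturbation hdet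
    have key (M : Matrix ι ι ℂ) : star (x • u + y • v) ⬝ᵥ (M *ᵥ (x • u + y • v)) =
        star u ⬝ᵥ (M *ᵥ u) + star v ⬝ᵥ (M *ᵥ v) + s * hermitianPairing M u v D := by
      rw [star_dotProduct_mulVec_add_smul, hx, hy, hxy]
      simp only [hermitianPairing, LinearMap.coe_mk, AddHom.coe_mk, star_mul',
        RCLike.star_def, Complex.conj_ofReal]
      push_cast
      ring
    refine ⟨x • u + y • v, ?_, ?_, ?_⟩
    · simpa [hI] using key 1
    · simpa [hC] using key C
    · rw [key G, Complex.add_re _ (_ * _), Complex.re_ofReal_mul]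
      have := mul_nonneg hs.le hG
      linarith

theorem exists_merge_sum {κ : Type*} (s : Finset κ) (C G : Matrix ι ι ℂ) (v : κ → ι → ℂ) :
    ∃ w : ι → ℂ, star w ⬝ᵥ w = ∑ i ∈ s, star (v i) ⬝ᵥ v i ∧
      star w ⬝ᵥ (C *ᵥ w) = ∑ i ∈ s, star (v i) ⬝ᵥ (C *ᵥ v i) ∧
      (∑ i ∈ s, star (v i) ⬝ᵥ (G *ᵥ v i)).re ≤ (star w ⬝ᵥ (G *ᵥ w)).re := by
  classical
  induction s using Finset.induction_on with
  | empty => exact ⟨0, by simp⟩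
  | insert k s hk ih =>
    obtain ⟨w, h1, h2, h3⟩ := ih
    obtain ⟨w', h1', h2', h3'⟩ := exists_merge C G (v k) w
    refine ⟨w', ?_, ?_, ?_⟩
    · rw [Finset.sum_insert hk, h1', h1]
    · rw [Finset.sum_insert hk, h2', h2]
    · rw [Finset.sum_insert hk]
      simp only [Complex.add_re] at h3' ⊢
      linarith

open scoped MatrixOrder Matrix.Norms.L2Operator in
theorem Matrix.PosSemidef.exists_eq_conjTranspose_mul_self {W : Matrix ι ι ℂ}
    (hW : W.PosSemidef) : ∃ V : Matrix ι ι ℂ, W = Vᴴ * V :=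
  CStarAlgebra.nonneg_iff_eq_star_mul_self.mp hW.nonneg

/-- A positive semidefinite matrix can be replaced by one of rank at most one, keeping its trace
and one complex linear functional, and not decreasing the real part of another. -/
theorem Matrix.PosSemidef.exists_vecMulVec {W : Matrix ι ι ℂ} (hW : W.PosSemidef)
    (C G : Matrix ι ι ℂ) :
    ∃ w : ι → ℂ, (vecMulVec w (star w)).trace = W.trace ∧
      (C * vecMulVec w (star w)).trace = (C * W).trace ∧
      (G * W).trace.re ≤ (G * vecMulVec w (star w)).trace.re := by
  obtain ⟨V, rfl⟩ := hW.exists_eq_conjTranspose_mul_self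
  -- The conjugated rows of `V` split `Vᴴ * V` into rank-one terms.
  have key (M : Matrix ι ι ℂ) :
      (M * (Vᴴ * V)).trace = ∑ i, star (star (V i)) ⬝ᵥ (M *ᵥ star (V i)) := by
    rw [← Matrix.mul_assoc, Matrix.trace_mul_comm, trace]
    refine Finset.sum_congr rfl fun i _ => ?_
    rw [star_star, Matrix.diag_apply, Matrix.mul_apply']
    rfl
  obtain ⟨w, h1, h2, h3⟩ := exists_merge_sum Finset.univ C G fun i => star (V i)
  refine ⟨w, ?_, ?_, ?_⟩
  · have := key 1
    rw [Matrix.one_mul] at this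
    rw [this, Matrix.trace_vecMulVec, dotProduct_comm, h1]
    simp
  · rw [key, trace_mul_vecMulVec_star, h2]
  · rw [key, trace_mul_vecMulVec_star]
    exact h3

/-! ### Semidefinite `2 × 2` matrices and Schur multipliers. -/

theorem vecMulVec_two (a b c d : ℂ) :
    Matrix.vecMulVec ![a, b] (star ![c, d]) = !![a * star c, a * star d; b * star c, b * star d] := by
  ext i j
  fin_cases i <;> fin_cases j <;> rfl

theorem posSemidef_two {x r : ℝ} (hx : 0 ≤ x) (hr : 0 ≤ r) (z : ℂ) :
    (!![((x * Complex.normSq z + r : ℝ) : ℂ), -(star z * x); -(z * x), (x : ℂ)] :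
      Matrix (Fin 2) (Fin 2) ℂ).PosSemidef := by
  have h1 : (r • Matrix.vecMulVec ![(1 : ℂ), 0] (star ![(1 : ℂ), 0])).PosSemidef :=
    (Matrix.posSemidef_vecMulVec_self_star _).smul hr
  have h2 : (x • Matrix.vecMulVec ![-star z, 1] (star ![-star z, 1])).PosSemidef :=
    (Matrix.posSemidef_vecMulVec_self_star _).smul hx
  rw [vecMulVec_two] at h1 h2
  convert h2.add h1 using 1
  ext i j
  fin_cases i <;> fin_cases j <;>
    simp [← Complex.mul_conj, mul_comm]

/-- A positive semidefinite `2 × 2` matrix is certified by the vector `![1, z]` that kills its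
second row: its quadratic form there is the Schur complement. -/
theorem Matrix.PosSemidef.exists_schur {x₁ x₂ y₂ x₃ : ℂ}
    (h : (!![x₁, x₂; y₂, x₃] : Matrix (Fin 2) (Fin 2) ℂ).PosSemidef) :
    ∃ z : ℂ, y₂ + z * x₃ = 0 ∧ 0 ≤ (x₁ + z * x₂).re := by
  have hdet := h.det_nonneg
  have h1 : 0 ≤ x₁ := h.diag_nonneg (i := 0)
  have h3 : 0 ≤ x₃ := h.diag_nonneg (i := 1)
  have hy : star x₂ = y₂ := h.1.apply 1 0
  subst hy
  obtain ⟨a, ha, rfl⟩ : ∃ a : ℝ, 0 ≤ a ∧ (a : ℂ) = x₁ := RCLike.nonneg_iff_exists_ofReal.1 h1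
  obtain ⟨c, hc, rfl⟩ : ∃ a : ℝ, 0 ≤ a ∧ (a : ℂ) = x₃ := RCLike.nonneg_iff_exists_ofReal.1 h3
  have hdet' : Complex.normSq x₂ ≤ a * c := by
    rw [Matrix.det_fin_two_of, RCLike.star_def, Complex.mul_conj] at hdet
    exact_mod_cast sub_nonneg.1 hdet
  rcases hc.eq_or_lt with rfl | hc
  · have : x₂ = 0 := Complex.normSq_eq_zero.1
      (le_antisymm (by simpa using hdet') (Complex.normSq_nonneg _))
    exact ⟨0, by simp [this], by simpa using ha⟩
  · have hc' : (c : ℂ) ≠ 0 := Complex.ofReal_ne_zero.2 hc.ne'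
    refine ⟨-star x₂ / c, by field_simp; ring, ?_⟩
    have : (a : ℂ) + -star x₂ / c * x₂ = ((a - Complex.normSq x₂ / c : ℝ) : ℂ) := by
      push_cast
      rw [← Complex.mul_conj, RCLike.star_def]
      ring
    rw [this, Complex.ofReal_re, sub_nonneg, div_le_iff₀ hc]
    exact hdet'

/-! ### Deflation. -/

section Deflation

variable {ι : Type*} [Fintype ι]

/-- The rank-one part `W u uᴴ W / (uᴴ W u)` of a positive semidefinite matrix `W` is below `W`. -/
theorem Matrix.PosSemidef.sub_deflation [DecidableEq ι] {W : Matrix ι ι ℂ} (hW : W.PosSemidef)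
    {u : ι → ℂ} {q : ℝ} (hq : q ≠ 0) (hu : star u ⬝ᵥ (W *ᵥ u) = q) :
    (W - q⁻¹ • (W * vecMulVec u (star u) * W)).PosSemidef := by
  have hq' : (q : ℂ) ≠ 0 := Complex.ofReal_ne_zero.2 hq
  set U := vecMulVec u (star u) with hU
  have hUU : U * W * U = (q : ℂ) • U := by
    rw [hU, Matrix.mul_assoc, Matrix.mul_vecMulVec, Matrix.vecMulVec_mul_vecMulVec, hu,
      vecMulVec_smul]
  have hUH : Uᴴ = U := by rw [hU, conjTranspose_vecMulVec, star_star]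
  -- The difference is the congruence `(1 - q⁻¹ W U) W (1 - q⁻¹ W U)ᴴ`, since `U W U = q U`.
  have h := hW.mul_mul_conjTranspose_same (1 - (q : ℂ)⁻¹ • (W * U))
  convert h using 1
  rw [conjTranspose_sub, conjTranspose_one, conjTranspose_smul, conjTranspose_mul, hUH,
    hW.1.eq, RCLike.star_def, map_inv₀, Complex.conj_ofReal]
  have e : (q⁻¹ : ℝ) • (W * U * W) = (q : ℂ)⁻¹ • (W * U * W) := by
    rw [← Complex.ofReal_inv, Complex.coe_smul]
  have h3 : W * U * W * (U * W) = (q : ℂ) • (W * U * W) := by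
    calc W * U * W * (U * W) = W * (U * W * U) * W := by simp only [Matrix.mul_assoc]
      _ = _ := by rw [hUU]; simp
  rw [e]
  simp only [sub_mul, mul_sub, Matrix.one_mul, Matrix.mul_one, smul_mul_assoc, mul_smul_comm, h3]
  rw [smul_smul, inv_mul_cancel₀ hq', one_smul, ← Matrix.mul_assoc, sub_self, smul_zero, sub_zero]

end Deflation

/-! ### Quadratic forms and outer products. -/

theorem quadForm_nonneg {n : ℕ} (u : EuclideanSpace ℂ (Fin n)) {M : Matrix (Fin n) (Fin n) ℂ}
    (hM : M.PosSemidef) : 0 ≤ quadForm u M :=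
  hM.re_dotProduct_nonneg u.ofLp

theorem Matrix.PosSemidef.ofReal_quadForm {n : ℕ} {M : Matrix (Fin n) (Fin n) ℂ}
    (hM : M.PosSemidef) (u : EuclideanSpace ℂ (Fin n)) :
    star u.ofLp ⬝ᵥ (M *ᵥ u.ofLp) = (quadForm u M : ℂ) :=
  (Complex.eq_re_of_ofReal_le (r := 0) (by simpa using hM.dotProduct_mulVec_nonneg u.ofLp))

theorem quadForm_sub {n : ℕ} (u : EuclideanSpace ℂ (Fin n)) (M N : Matrix (Fin n) (Fin n) ℂ) :
    quadForm u (M - N) = quadForm u M - quadForm u N := by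
  simp [quadForm, Matrix.sub_mulVec, dotProduct_sub]

theorem quadForm_smul {n : ℕ} (u : EuclideanSpace ℂ (Fin n)) (c : ℝ)
    (M : Matrix (Fin n) (Fin n) ℂ) : quadForm u (c • M) = c * quadForm u M := by
  simp [quadForm, Matrix.smul_mulVec, dotProduct_smul]

theorem quadForm_sum {n : ℕ} (u : EuclideanSpace ℂ (Fin n)) {κ : Type*} (s : Finset κ)
    (M : κ → Matrix (Fin n) (Fin n) ℂ) :
    quadForm u (∑ i ∈ s, M i) = ∑ i ∈ s, quadForm u (M i) := by
  simp [quadForm, Matrix.sum_mulVec, dotProduct_sum]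

theorem mul_outer_mul {n : ℕ} {M : Matrix (Fin n) (Fin n) ℂ} (hM : M.IsHermitian)
    (u : EuclideanSpace ℂ (Fin n)) :
    M * outer u u * M = outer (mulVecE M u) (mulVecE M u) := by
  simp [outer, mulVecE, Matrix.mul_vecMulVec, Matrix.vecMulVec_mul, Matrix.star_mulVec, hM.eq]

theorem posSemidef_outer {n : ℕ} (u : EuclideanSpace ℂ (Fin n)) : (outer u u).PosSemidef :=
  Matrix.posSemidef_vecMulVec_self_star _

theorem trace_outer {n : ℕ} (u : EuclideanSpace ℂ (Fin n)) :
    (outer u u).trace = ((‖u‖ ^ 2 : ℝ) : ℂ) := by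
  rw [outer, Matrix.trace_vecMulVec, EuclideanSpace.norm_sq_eq]
  simp [dotProduct, Complex.mul_conj, Complex.normSq_eq_norm_sq]

theorem quadForm_outer_mulVecE {n : ℕ} {M : Matrix (Fin n) (Fin n) ℂ} (hM : M.PosSemidef)
    (u : EuclideanSpace ℂ (Fin n)) :
    quadForm u (outer (mulVecE M u) (mulVecE M u)) = quadForm u M ^ 2 := by
  rw [quadForm, outer, Matrix.vecMulVec_mulVec]
  have h := hM.ofReal_quadForm u
  have h2 : star (M *ᵥ u.ofLp) ⬝ᵥ u.ofLp = (quadForm u M : ℂ) := by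
    rw [Matrix.star_mulVec, hM.1.eq, ← Matrix.dotProduct_mulVec, h]
  simp only [mulVecE]
  rw [h2]
  simp [h, dotProduct_smul, sq]

/-! ### The sensing matrices `A₁` and `A₃`. -/

namespace ISACSystem

variable {NT NR K : ℕ} (S : ISACSystem NT NR K)

theorem star_outer_apply {n : ℕ} (u : EuclideanSpace ℂ (Fin n)) (i j : Fin n) :
    star (outer u u j i) = outer u u i j := by
  simp [outer, Matrix.vecMulVec_apply, mul_comm]

theorem isHermitian_A₁ : S.A₁.IsHermitian := by
  ext i j
  simp only [A₁, Matrix.conjTranspose_apply, Matrix.of_apply]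
  rw [RCLike.star_def, ← intervalIntegral.intervalIntegral_conj]
  congr 1
  ext θ
  simp only [map_mul, map_add, Complex.conj_ofReal, map_natCast, ← RCLike.star_def,
    star_outer_apply]

theorem quadratic_A₃ (ha : ContDiff ℝ 1 (S.a S.φ))
    (hp_int : IntervalIntegrable S.p MeasureTheory.volume (-Real.pi) Real.pi)
    (x : Fin NT → ℂ) :
    star x ⬝ᵥ (S.A₃ *ᵥ x) = (NR : ℂ) * ((∫ θ in (-Real.pi)..Real.pi,
      ‖star x ⬝ᵥ (S.a S.φ θ).ofLp‖ ^ 2 * S.p θ : ℝ) : ℂ) := by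
  have hcont (i : Fin NT) : Continuous fun θ => S.a S.φ θ i :=
    (EuclideanSpace.proj (𝕜 := ℂ) i).continuous.comp ha.continuous
  have hint (i j : Fin NT) : IntervalIntegrable
      (fun θ => outer (S.a S.φ θ) (S.a S.φ θ) i j * (S.p θ : ℂ))
      MeasureTheory.volume (-Real.pi) Real.pi := by
    have hp : IntervalIntegrable (fun θ => (S.p θ : ℂ)) MeasureTheory.volume
        (-Real.pi) Real.pi := ⟨hp_int.1.ofReal, hp_int.2.ofReal⟩
    refine hp.continuousOn_mul (Continuous.continuousOn ?_)
    exact (hcont i).mul (hcont j).star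
  have hint' (i : Fin NT) : IntervalIntegrable
      (fun θ => ∑ j, star (x i) * (outer (S.a S.φ θ) (S.a S.φ θ) i j * (S.p θ : ℂ)) * x j)
      MeasureTheory.volume (-Real.pi) Real.pi := by
    have := IntervalIntegrable.sum (μ := MeasureTheory.volume) (a := -Real.pi) (b := Real.pi)
      Finset.univ (f := fun j θ =>
        star (x i) * (outer (S.a S.φ θ) (S.a S.φ θ) i j * (S.p θ : ℂ)) * x j)
      fun j _ => ((hint i j).const_mul _).mul_const _
    rwa [Finset.sum_fn] at this
  have hpt (θ : ℝ) : ((‖star x ⬝ᵥ (S.a S.φ θ).ofLp‖ ^ 2 * S.p θ : ℝ) : ℂ) =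
      ∑ i, ∑ j, star (x i) * (outer (S.a S.φ θ) (S.a S.φ θ) i j * (S.p θ : ℂ)) * x j := by
    have h1 : ((‖star x ⬝ᵥ (S.a S.φ θ).ofLp‖ ^ 2 : ℝ) : ℂ) =
        (star x ⬝ᵥ (S.a S.φ θ).ofLp) * star (star x ⬝ᵥ (S.a S.φ θ).ofLp) := by
      rw [RCLike.star_def, Complex.mul_conj, Complex.normSq_eq_norm_sq]
    rw [Complex.ofReal_mul, h1]
    simp only [dotProduct, star_sum, star_mul', Pi.star_apply, star_star]
    rw [Finset.sum_mul_sum, Finset.sum_mul]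
    refine Finset.sum_congr rfl fun i _ => ?_
    rw [Finset.sum_mul]
    refine Finset.sum_congr rfl fun j _ => ?_
    simp only [outer, Matrix.vecMulVec_apply, Pi.star_apply]
    ring
  rw [← intervalIntegral.integral_ofReal]
  simp_rw [hpt]
  rw [intervalIntegral.integral_finsetSum fun i _ =>
    hint' i]
  simp only [dotProduct, Matrix.mulVec, Finset.mul_sum]
  refine Finset.sum_congr rfl fun i _ => ?_
  rw [intervalIntegral.integral_finsetSum fun j _ => ((hint i j).const_mul _).mul_const _,
    Finset.mul_sum]
  refine Finset.sum_congr rfl fun j _ => ?_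
  rw [intervalIntegral.integral_mul_const, intervalIntegral.integral_const_mul]
  simp only [A₃, Matrix.of_apply, Pi.star_apply]
  ring

theorem posSemidef_A₃ (ha : ContDiff ℝ 1 (S.a S.φ))
    (hp_nonneg : ∀ θ ∈ Set.Ico (-Real.pi) Real.pi, 0 ≤ S.p θ)
    (hp_int : IntervalIntegrable S.p MeasureTheory.volume (-Real.pi) Real.pi) :
    S.A₃.PosSemidef := by
  refine .of_dotProduct_mulVec_nonneg ?_ fun x => ?_
  · ext i j
    simp only [A₃, Matrix.conjTranspose_apply, Matrix.of_apply]
    rw [RCLike.star_def, map_mul, ← intervalIntegral.intervalIntegral_conj, map_natCast]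
    congr 2
    ext θ
    simp only [map_mul, Complex.conj_ofReal, ← RCLike.star_def, star_outer_apply]
  · rw [quadratic_A₃ S ha hp_int]
    refine mul_nonneg (Nat.cast_nonneg _) (Complex.zero_le_real.2 ?_)
    rw [intervalIntegral.integral_of_le (by linarith [Real.pi_pos]),
      ← MeasureTheory.integral_Ico_eq_integral_Ioc]
    exact MeasureTheory.setIntegral_nonneg measurableSet_Ico fun θ hθ =>
      mul_nonneg (sq_nonneg _) (hp_nonneg θ hθ)

end ISACSystem

theorem Matrix.PosSemidef.trace_mul_nonneg {ι : Type*} [Fintype ι] [DecidableEq ι]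
    {A M : Matrix ι ι ℂ} (hA : A.PosSemidef) (hM : M.PosSemidef) : 0 ≤ (A * M).trace := by
  obtain ⟨V, rfl⟩ := hM.exists_eq_conjTranspose_mul_self
  rw [← Matrix.mul_assoc, Matrix.trace_mul_comm, ← Matrix.mul_assoc]
  exact (hA.mul_mul_conjTranspose_same V).trace_nonneg

theorem Matrix.IsHermitian.star_trace_mul {ι : Type*} [Fintype ι] (A : Matrix ι ι ℂ)
    {M : Matrix ι ι ℂ} (hM : M.IsHermitian) : star (A * M).trace = (Aᴴ * M).trace := by
  rw [← Matrix.trace_conjTranspose, Matrix.conjTranspose_mul, hM.eq, Matrix.trace_mul_comm]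

/-! ### Sensing and rate constraints. -/

namespace ISACSystem

variable {NT NR K : ℕ} (S : ISACSystem NT NR K)

/-- Since `z` still kills the second row, the new matrix has the shape in `posSemidef_two`, with `c
= tr (A₃ R')`; the slack `r` is the new Schur complement, which is at least the old one. -/
theorem B_posSemidef_of_trace_le (hA₁ : S.A₁.IsHermitian) (hA₃ : S.A₃.PosSemidef)
    {t : ℝ} {W W' : Fin K → Matrix (Fin NT) (Fin NT) ℂ} {WS WS' : Matrix (Fin NT) (Fin NT) ℂ}
    (hR' : (RX W' WS').PosSemidef) {z : ℂ}
    (hz : (S.A₂ᴴ * RX W WS).trace + z * (S.A₃ * RX W WS).trace = 0)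
    (hschur : 0 ≤ ((S.A₁ * RX W WS).trace - (t : ℂ) + z * (S.A₂ * RX W WS).trace).re)
    (h₁ : ((S.A₂ᴴ + z • S.A₃) * RX W' WS').trace = ((S.A₂ᴴ + z • S.A₃) * RX W WS).trace)
    (h₂ : ((S.A₁ + z • S.A₂) * RX W WS).trace.re ≤ ((S.A₁ + z • S.A₂) * RX W' WS').trace.re) :
    (S.B t W' WS').PosSemidef := by
  set R := RX W WS
  set R' := RX W' WS'
  simp only [Matrix.add_mul, Matrix.smul_mul, Matrix.trace_add, Matrix.trace_smul,
    smul_eq_mul] at h₁ h₂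
  rw [hz] at h₁
  obtain ⟨c, hc, hx₃⟩ : ∃ c : ℝ, 0 ≤ c ∧ (c : ℂ) = (S.A₃ * R').trace :=
    RCLike.nonneg_iff_exists_ofReal.1 (hA₃.trace_mul_nonneg hR')
  have hx₁ : (((S.A₁ * R').trace.re : ℝ) : ℂ) = (S.A₁ * R').trace := by
    rw [← Complex.conj_eq_iff_re, ← RCLike.star_def, hR'.1.star_trace_mul, hA₁.eq]
  have hy₂ : (S.A₂ᴴ * R').trace = -(z * c) := by
    rw [← hx₃] at h₁
    linear_combination h₁
  have hx₂ : (S.A₂ * R').trace = -(star z * c) := by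
    have := hR'.1.star_trace_mul S.A₂ᴴ
    rw [Matrix.conjTranspose_conjTranspose, hy₂] at this
    rw [← this, star_neg, star_mul', RCLike.star_def, Complex.conj_ofReal]
  have hzz : z * (S.A₂ * R').trace = ((-(c * Complex.normSq z) : ℝ) : ℂ) := by
    rw [hx₂]
    push_cast
    rw [← Complex.mul_conj, RCLike.star_def]
    ring
  have hr : 0 ≤ (S.A₁ * R').trace.re - t - c * Complex.normSq z := by
    rw [Complex.add_re _ (z * (S.A₂ * R').trace), hzz, Complex.ofReal_re] at h₂
    simp only [Complex.add_re, Complex.sub_re, Complex.ofReal_re] at hschur h₂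
    linarith
  convert posSemidef_two hc hr z using 1
  have h11 : (S.A₁ * R').trace - (t : ℂ) = ((c * Complex.normSq z +
      ((S.A₁ * R').trace.re - t - c * Complex.normSq z) : ℝ) : ℂ) := by
    rw [← hx₁]
    push_cast
    simp
  rw [B, ← h11, ← hx₂, ← hy₂, hx₃]

theorem γ_pos (hR : ∀ k, 0 < S.Rbar k) (k : Fin K) : 0 < S.γ k :=
  sub_pos.2 (Real.one_lt_rpow one_lt_two (hR k))

theorem quadForm_interference {n : ℕ} (u : EuclideanSpace ℂ (Fin n)) (k : Fin K) (c : ℝ)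
    (W : Fin K → Matrix (Fin n) (Fin n) ℂ) :
    quadForm u (W k - c • ∑ i ∈ Finset.univ.erase k, W i) =
      quadForm u (W k) - c * ∑ i ∈ Finset.univ.erase k, quadForm u (W i) := by
  rw [quadForm_sub, quadForm_smul, quadForm_sum]

variable {S}

theorem IsFeasible.quadForm_pos {t : ℝ} {W : Fin K → Matrix (Fin NT) (Fin NT) ℂ}
    {WS : Matrix (Fin NT) (Fin NT) ℂ} (h : S.IsFeasible t W WS) (hσ : ∀ k, 0 < S.σ k)
    (hR : ∀ k, 0 < S.Rbar k) (k : Fin K) : 0 < quadForm (S.h k) (W k) := by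
  have hr := h.rate k
  rw [quadForm_interference] at hr
  have hγ := S.γ_pos hR k
  have h1 : 0 < S.γ k * S.σ k ^ 2 := mul_pos hγ (pow_pos (hσ k) 2)
  have h2 : 0 ≤ S.γ k * ∑ i ∈ Finset.univ.erase k, quadForm (S.h k) (W i) :=
    mul_nonneg hγ.le (Finset.sum_nonneg fun i _ => quadForm_nonneg _ (h.comm_psd i))
  linarith

end ISACSystem

/-! ### Construction of the rank-one optimal solution. -/

theorem mulVecE_ne_zero_of_quadForm_pos {n : ℕ} {M : Matrix (Fin n) (Fin n) ℂ}
    {u : EuclideanSpace ℂ (Fin n)} (h : 0 < quadForm u M) : mulVecE M u ≠ 0 := by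
  intro h0
  have : M *ᵥ u.ofLp = 0 := congrArg WithLp.ofLp h0
  simp [quadForm, this] at h

theorem proposition2 {NT NR K : ℕ} (S : ISACSystem NT NR K)
    (ha : ContDiff ℝ 1 (S.a S.φ)) (hb : ContDiff ℝ 1 (S.b S.φ))
    (hp_nonneg : ∀ θ ∈ Set.Ico (-Real.pi) Real.pi, 0 ≤ S.p θ)
    (hp_int : IntervalIntegrable S.p MeasureTheory.volume (-Real.pi) Real.pi)
    (hp_one : (∫ θ in (-Real.pi)..Real.pi, S.p θ) = 1)
    (hσ : ∀ k, 0 < S.σ k) (hR : ∀ k, 0 < S.Rbar k)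
    (t : ℝ) (W : Fin K → Matrix (Fin NT) (Fin NT) ℂ) (WS : Matrix (Fin NT) (Fin NT) ℂ)
    (hopt : S.IsOptimal t W WS) :
    (∀ k, mulVecE (W k) (S.h k) ≠ 0) ∧
    ∃ (β : Fin K → ℝ) (WShat : Matrix (Fin NT) (Fin NT) ℂ),
      (∀ k, 0 < β k ∧ β k ≤ 1) ∧ (∑ k, β k) ≤ 1 ∧
      S.IsOptimal t
        (fun k => (β k * S.P / ‖mulVecE (W k) (S.h k)‖ ^ 2) •
          (W k * outer (S.h k) (S.h k) * W k))
        WShat ∧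
      WShat.rank ≤ 1 := by
  obtain ⟨hf, hmax⟩ := hopt
  have hq := hf.quadForm_pos hσ hR
  have hne (k : Fin K) : mulVecE (W k) (S.h k) ≠ 0 := mulVecE_ne_zero_of_quadForm_pos (hq k)
  refine ⟨hne, ?_⟩
  set q : Fin K → ℝ := fun k => quadForm (S.h k) (W k)
  set V : Fin K → Matrix (Fin NT) (Fin NT) ℂ := fun k =>
    (q k)⁻¹ • (W k * outer (S.h k) (S.h k) * W k) with hV
  have hV_eq (k : Fin K) : V k = (q k)⁻¹ •
      outer (mulVecE (W k) (S.h k)) (mulVecE (W k) (S.h k)) := by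
    rw [hV, ← mul_outer_mul (hf.comm_psd k).1]
  have hV_psd (k : Fin K) : (V k).PosSemidef := by
    rw [hV_eq]
    exact (posSemidef_outer _).smul (inv_nonneg.2 (hq k).le)
  have hsub (k : Fin K) : (W k - V k).PosSemidef :=
    (hf.comm_psd k).sub_deflation (hq k).ne' ((hf.comm_psd k).ofReal_quadForm _)
  have hV_quad (k : Fin K) : quadForm (S.h k) (V k) = q k := by
    rw [hV_eq, quadForm_smul, quadForm_outer_mulVecE (hf.comm_psd k), sq]
    exact inv_mul_cancel_left₀ (hq k).ne' _
  have hV_le (j k : Fin K) : quadForm (S.h k) (V j) ≤ quadForm (S.h k) (W j) := by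
    have := quadForm_nonneg (S.h k) (hsub j)
    rw [quadForm_sub] at this
    linarith
  have hV_trace (k : Fin K) :
      (V k).trace.re = (q k)⁻¹ * ‖mulVecE (W k) (S.h k)‖ ^ 2 := by
    rw [hV_eq, Matrix.trace_smul, trace_outer, Complex.real_smul, ← Complex.ofReal_mul,
      Complex.ofReal_re]
  have hV_trace_pos (k : Fin K) : 0 < (V k).trace.re := by
    rw [hV_trace]
    exact mul_pos (inv_pos.2 (hq k)) (pow_pos (norm_pos_iff.2 (hne k)) 2)
  set T : Matrix (Fin NT) (Fin NT) ℂ := ∑ k, (W k - V k) + WS with hT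
  have hT_psd : T.PosSemidef := (Matrix.posSemidef_sum _ fun k _ => hsub k).add hf.sens_psd
  have hRX : ISACSystem.RX V T = ISACSystem.RX W WS := by
    rw [ISACSystem.RX, ISACSystem.RX, hT, Finset.sum_sub_distrib]
    abel
  have hpow : (∑ k, (V k).trace.re) + T.trace.re ≤ S.P := by
    have h : ((∑ k, V k) + T).trace.re ≤ S.P :=
      (congrArg (fun M => (Matrix.trace M).re) hRX).trans_le hf.power
    rwa [Matrix.trace_add, Matrix.trace_sum, Complex.add_re, Complex.re_sum] at h
  have hT_trace : 0 ≤ T.trace.re := (Complex.nonneg_iff.1 hT_psd.trace_nonneg).1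
  have hVsum : ∑ k, (V k).trace.re ≤ S.P := by linarith
  have hP (k : Fin K) : 0 < S.P :=
    (hV_trace_pos k).trans_le <| (Finset.single_le_sum (f := fun k => (V k).trace.re)
      (fun i _ => (hV_trace_pos i).le) (Finset.mem_univ k)).trans hVsum
  obtain ⟨z, hz, hschur⟩ := hf.sensing.exists_schur
  obtain ⟨w, hw1, hw2, hw3⟩ := hT_psd.exists_vecMulVec (S.A₂ᴴ + z • S.A₃) (S.A₁ + z • S.A₂)
  set T' := Matrix.vecMulVec w (star w)
  have hT'_psd : T'.PosSemidef := Matrix.posSemidef_vecMulVec_self_star _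
  -- `β k` is the share of the budget spent on `V k`; with it the prescribed beamformer equals `V
  -- k`.
  set β : Fin K → ℝ := fun k => (V k).trace.re / S.P with hβ
  have hβ_pos (k : Fin K) : 0 < β k := div_pos (hV_trace_pos k) (hP k)
  have hβ_sum : ∑ k, β k ≤ 1 := by
    rw [hβ, ← Finset.sum_div]
    rcases isEmpty_or_nonempty (Fin K) with h | ⟨⟨k⟩⟩
    · simp
    · rwa [div_le_one (hP k)]
  have hβV : (fun k => (β k * S.P / ‖mulVecE (W k) (S.h k)‖ ^ 2) •
      (W k * outer (S.h k) (S.h k) * W k)) = V := by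
    funext k
    have hn : ‖mulVecE (W k) (S.h k)‖ ^ 2 ≠ 0 := pow_ne_zero 2 (norm_ne_zero_iff.2 (hne k))
    simp only [hβ]
    rw [div_mul_cancel₀ _ (hP k).ne', hV_trace, mul_div_assoc, div_self hn, mul_one]
  refine ⟨β, T', fun k => ⟨hβ_pos k, ?_⟩, hβ_sum, ?_, Matrix.rank_vecMulVec_le _ _⟩
  · exact (Finset.single_le_sum (fun i _ => (hβ_pos i).le) (Finset.mem_univ k)).trans hβ_sum
  rw [hβV]
  -- The objective `t` is unchanged, so only feasibility needs proof.
  refine ⟨⟨?_, fun k => ?_, ?_, hV_psd, hT'_psd⟩, hmax⟩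
  · refine S.B_posSemidef_of_trace_le S.isHermitian_A₁ (S.posSemidef_A₃ ha hp_nonneg hp_int)
      ((Matrix.posSemidef_sum _ fun k _ => hV_psd k).add hT'_psd) hz hschur ?_ ?_
    · rw [← hRX]
      simp only [ISACSystem.RX, Matrix.mul_add _ (∑ k, V k), Matrix.trace_add _ (_ * _)]
      rw [hw2]
    · rw [← hRX]
      simp only [ISACSystem.RX, Matrix.mul_add _ (∑ k, V k), Matrix.trace_add _ (_ * _),
        Complex.add_re]
      linarith
  · have h := hf.rate k
    rw [ISACSystem.quadForm_interference] at h ⊢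
    rw [hV_quad]
    refine h.trans (sub_le_sub_left (mul_le_mul_of_nonneg_left ?_ (S.γ_pos hR k).le) _)
    exact Finset.sum_le_sum fun j _ => hV_le j k
  · rw [Matrix.trace_add, Matrix.trace_sum, Complex.add_re, Complex.re_sum, hw1]
    exact hpow
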